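/- Let $\mathbb T=\mathbb R/2\pi\mathbb Z$, $D_t=-i\partial_t$, $D_x=-i\partial_x$, and let $E=D_x^2=-\partial_x^2$ on $\mathbb T$, with eigenvalues $j^2$, $j\in\mathbb N_0$, and eigenspaces spanned by $e_j^1=e^{-ijx}$, $e_j^2=e^{ijx}$ (by the constant $1$ if $j=0$). A continuous linear operator $A:\mathcal D'(\mathbb T)\to\mathcal D'(\mathbb T)$ such that the domain of $A^*$ contains $C^\infty(\mathbb T)$ is called $E$-invariant if $AE=EA$; its matrix symbol $(A_j)_{j\ge 0}$ consists of the matrices $A_j$ of the restrictions of $A$ to these eigenspaces in the above bases, and its order is the infimum of all $N\in\mathbb R$ such that $\max_{k,l}|(A_j)_{kl}|=O(j^N)$ as $j\to\infty$. For such an $A$ with symbol of at most polynomial growth, acting on $\mathcal D'(\mathbb T^2)$ in the variable $x$, the operator $L=D_t+A$ on $\mathbb T^2\ni(t,x)$ is globally hypoelliptic if $u\in\mathcal D'(\mathbb T^2)$ and $Lu\in C^\infty(\mathbb T^2)$ imply $u\in C^\infty(\mathbb T^2)$. Theorem 4.4. For every irrational real number $\alpha$ there are $E$-invariant operators $\mathcal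 S$ and $\mathcal R$ on $\mathcal D'(\mathbb T)$ with the following properties. 1. (Commutative perturbation.) $[D_x,\mathcal S]=0$; the symbol of $\mathcal S$ is $\mathcal S_0=0$, $\mathcal S_j=\begin{pmatrix} r_j&0\\0&r_j\end{pmatrix}$ for $j\ge1$, with real $r_j$; $\|\mathcal S_j\|=O(j^{1/2})$, so that $\mathcal S$ has order $\le 1/2$; and $D_t+\alpha D_x+\mathcal S$ is not globally hypoelliptic. 2. (Non-commutative perturbation.) $[D_x,\mathcal R]\ne0$; the symbol of $\mathcal R$ is $\mathcal R_0=0$, $\mathcal R_j=\begin{pmatrix}0&\gamma_j\\ \gamma_j&0\end{pmatrix}$ for $j\ge1$, with real $\gamma_j$; $\|\mathcal R_j\|=O(j^{1/2})$, so that $\mathcal R$ has order $\le1/2$; there are positive integers $q_1<q_2<\cdots$ and integers $p_k$ with $\sqrt{\alpha^2q_k^2+\gamma_{q_k}^2}=p_k$ for all $k$; and $D_t+\alpha D_x+\mathcal R$ is not globally hypoelliptic. -/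

import Mathlib

open scoped ContDiff

namespace TorusGH

noncomputable section

/-! ### Smooth functions on a torus, with their Frechet topology -/

section Smooth

variable {E : Type*} [NormedAddCommGroup E] [NormedSpace ℝ E]

/-- Smooth complex functions on `E` that are periodic with respect to the subgroup `Γ`. -/
def smoothSubmodule (Γ : AddSubgroup E) : Submodule ℂ (E → ℂ) where
  carrier := {f | ContDiff ℝ ∞ f ∧ ∀ γ ∈ Γ, ∀ x, f (x + γ) = f x}
  add_mem' {f g} hf hg :=
    ⟨hf.1.add hg.1, fun γ hγ x => by simp [hf.2 γ hγ x, hg.2 γ hγ x]⟩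
  zero_mem' := ⟨contDiff_const, fun _ _ _ => rfl⟩
  smul_mem' c f hf := ⟨hf.1.const_smul c, fun γ hγ x => by simp [hf.2 γ hγ x]⟩

/-- The space `C^∞(E / Γ)`, realised as the smooth `Γ`-periodic functions on `E`. -/
def Smooth (Γ : AddSubgroup E) : Type _ := smoothSubmodule Γ

variable {Γ : AddSubgroup E}

instance : AddCommGroup (Smooth Γ) := inferInstanceAs (AddCommGroup (smoothSubmodule Γ))

instance : Module ℂ (Smooth Γ) := inferInstanceAs (Module ℂ (smoothSubmodule Γ))

instance : FunLike (Smooth Γ) E ℂ where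
  coe f := f.1
  coe_injective := Subtype.val_injective

/-- Bundle a smooth periodic function. -/
def Smooth.mk (f : E → ℂ) (hf : ContDiff ℝ ∞ f) (hp : ∀ γ ∈ Γ, ∀ x, f (x + γ) = f x) : Smooth Γ :=
  ⟨f, hf, hp⟩

@[simp] theorem Smooth.mk_apply (f : E → ℂ) (hf : ContDiff ℝ ∞ f)
    (hp : ∀ γ ∈ Γ, ∀ x, f (x + γ) = f x) (x : E) : (Smooth.mk f hf hp : Smooth Γ) x = f x := rfl

@[ext] theorem Smooth.ext {f g : Smooth Γ} (h : ∀ x, f x = g x) : f = g := DFunLike.ext f g h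

theorem Smooth.contDiff (f : Smooth Γ) : ContDiff ℝ ∞ f := f.2.1

theorem Smooth.periodic (f : Smooth Γ) {γ : E} (hγ : γ ∈ Γ) (x : E) : f (x + γ) = f x :=
  f.2.2 γ hγ x

theorem Smooth.coe_add (f g : Smooth Γ) : (⇑(f + g) : E → ℂ) = ⇑f + ⇑g := rfl

theorem Smooth.coe_smul (c : ℂ) (f : Smooth Γ) : (⇑(c • f) : E → ℂ) = c • ⇑f := rfl

@[simp] theorem Smooth.add_apply (f g : Smooth Γ) (x : E) : (f + g) x = f x + g x := rfl

@[simp] theorem Smooth.smul_apply (c : ℂ) (f : Smooth Γ) (x : E) : (c • f) x = c * f x := rfl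

/-- The quotient `E / Γ` is compact: some compact set meets every `Γ`-orbit. -/
class Cocompact (Γ : AddSubgroup E) : Prop where
  exists_compact : ∃ K : Set E, IsCompact K ∧ ∀ x, ∃ γ ∈ Γ, x + γ ∈ K

theorem Smooth.iteratedFDeriv_periodic (f : Smooth Γ) (k : ℕ) {γ : E} (hγ : γ ∈ Γ) (x : E) :
    iteratedFDeriv ℝ k f (x + γ) = iteratedFDeriv ℝ k f x := by
  rw [← iteratedFDeriv_comp_add_right]
  congr 1
  funext y
  exact f.periodic hγ y

theorem Smooth.bddAbove [Cocompact Γ] (f : Smooth Γ) (k : ℕ) :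
    BddAbove (Set.range fun x => ‖iteratedFDeriv ℝ k f x‖) := by
  obtain ⟨K, hK, hc⟩ := Cocompact.exists_compact (Γ := Γ)
  have hcont : Continuous fun x => ‖iteratedFDeriv ℝ k f x‖ :=
    (f.contDiff.continuous_iteratedFDeriv (by exact_mod_cast le_top)).norm
  obtain ⟨C, hC⟩ := (hK.image hcont).bddAbove
  refine ⟨C, ?_⟩
  rintro _ ⟨x, rfl⟩
  obtain ⟨γ, hγ, hx⟩ := hc x
  have := hC ⟨x + γ, hx, rfl⟩
  simpa [f.iteratedFDeriv_periodic k hγ x] using this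

/-- The seminorm `f ↦ sup_x ‖D^k f(x)‖` on `C^∞(E / Γ)`. -/
def smoothSeminorm (Γ : AddSubgroup E) [Cocompact Γ] (k : ℕ) : Seminorm ℂ (Smooth Γ) :=
  Seminorm.ofSMulLE (fun f => ⨆ x, ‖iteratedFDeriv ℝ k f x‖)
    (by
      have h : iteratedFDeriv ℝ k (⇑(0 : Smooth Γ)) = 0 := iteratedFDeriv_zero
      simp [h])
    (fun f g => by
      refine ciSup_le fun x => ?_
      have h : iteratedFDeriv ℝ k (⇑(f + g)) x
          = iteratedFDeriv ℝ k f x + iteratedFDeriv ℝ k g x := by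
        rw [Smooth.coe_add]
        exact iteratedFDeriv_add_apply
          (f.contDiff.contDiffAt.of_le (by exact_mod_cast le_top))
          (g.contDiff.contDiffAt.of_le (by exact_mod_cast le_top))
      rw [h]
      exact (norm_add_le _ _).trans
        (add_le_add (le_ciSup (f.bddAbove k) x) (le_ciSup (g.bddAbove k) x)))
    (fun c f => by
      refine ciSup_le fun x => ?_
      have h : iteratedFDeriv ℝ k (⇑(c • f)) x = c • iteratedFDeriv ℝ k f x := by
        rw [Smooth.coe_smul]
        exact iteratedFDeriv_const_smul_apply
          (f.contDiff.contDiffAt.of_le (by exact_mod_cast le_top))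
      rw [h, norm_smul]
      exact mul_le_mul_of_nonneg_left (le_ciSup (f.bddAbove k) x) (norm_nonneg c))

/-- The family of all the seminorms `f ↦ sup_x ‖D^k f(x)‖`. -/
abbrev smoothSeminorms (Γ : AddSubgroup E) [Cocompact Γ] : SeminormFamily ℂ (Smooth Γ) ℕ :=
  smoothSeminorm Γ

theorem le_smoothSeminorm [Cocompact Γ] (k : ℕ) (f : Smooth Γ) (x : E) :
    ‖iteratedFDeriv ℝ k f x‖ ≤ smoothSeminorm Γ k f :=
  le_ciSup (f.bddAbove k) x

theorem smoothSeminorm_le [Cocompact Γ] (k : ℕ) (f : Smooth Γ) {C : ℝ}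
    (h : ∀ x, ‖iteratedFDeriv ℝ k f x‖ ≤ C) : smoothSeminorm Γ k f ≤ C :=
  ciSup_le h

theorem norm_le_smoothSeminorm_zero [Cocompact Γ] (f : Smooth Γ) (x : E) :
    ‖f x‖ ≤ smoothSeminorm Γ 0 f := by
  simpa using le_smoothSeminorm 0 f x

/-- The Frechet topology of `C^∞(E / Γ)`: uniform convergence of all derivatives. -/
instance [Cocompact Γ] : TopologicalSpace (Smooth Γ) :=
  (smoothSeminorms Γ).moduleFilterBasis.topology

theorem withSeminorms [Cocompact Γ] :
    WithSeminorms (smoothSeminorms Γ) := ⟨rfl⟩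

instance [Cocompact Γ] : IsTopologicalAddGroup (Smooth Γ) := withSeminorms.topologicalAddGroup

instance [Cocompact Γ] : ContinuousSMul ℂ (Smooth Γ) := withSeminorms.continuousSMul

/-- Distributions on `E / Γ`: continuous linear functionals on `C^∞(E / Γ)`, with the strong
topology (uniform convergence on bounded sets of test functions). -/
abbrev Dist (Γ : AddSubgroup E) [Cocompact Γ] : Type _ := Smooth Γ →L[ℂ] ℂ

/-- Complex conjugation of a smooth function. -/
def Smooth.conj (f : Smooth Γ) : Smooth Γ :=
  Smooth.mk (fun x => starRingEnd ℂ (f x))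
    (Complex.conjCLE.contDiff.comp f.contDiff)
    (fun γ hγ x => by rw [f.periodic hγ])

/-- The linear functional `φ ↦ ∫_F f φ` for a set `F` of finite volume. -/
def Smooth.toLinOn [MeasureTheory.MeasureSpace E] [OpensMeasurableSpace E] [SecondCountableTopology E]
    [Cocompact Γ] (F : Set E) (hF : MeasureTheory.volume F < ⊤) (f : Smooth Γ) : Smooth Γ →ₗ[ℂ] ℂ where
  toFun φ := ∫ x in F, f x * φ x
  map_add' φ ψ := by
    have hint : ∀ χ : Smooth Γ, MeasureTheory.IntegrableOn (fun x => f x * χ x) F := fun χ =>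
      MeasureTheory.Measure.integrableOn_of_bounded hF.ne
        (M := smoothSeminorm Γ 0 f * smoothSeminorm Γ 0 χ)
        (f.contDiff.continuous.mul χ.contDiff.continuous).aestronglyMeasurable
        (Filter.Eventually.of_forall fun x => by
          rw [norm_mul]
          exact mul_le_mul (norm_le_smoothSeminorm_zero f x) (norm_le_smoothSeminorm_zero χ x)
            (norm_nonneg _) (apply_nonneg _ _))
    rw [← MeasureTheory.integral_add (hint φ) (hint ψ)]
    simp [mul_add]
  map_smul' c φ := by
    rw [RingHom.id_apply, smul_eq_mul, ← MeasureTheory.integral_const_mul]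
    congr 1
    funext x
    simp only [Smooth.smul_apply]
    ring

/-- The distribution `φ ↦ ∫_F f φ` defined by a smooth function `f`; here `F` is a fundamental
domain of finite volume. -/
def Smooth.toDistOn [MeasureTheory.MeasureSpace E] [OpensMeasurableSpace E]
    [SecondCountableTopology E] [Cocompact Γ] (F : Set E) (hF : MeasureTheory.volume F < ⊤)
    (f : Smooth Γ) : Dist Γ where
  toLinearMap := f.toLinOn F hF
  cont := by
    refine WithSeminorms.continuous_normedSpace_rng ℂ (withSeminorms (Γ := Γ)) (f.toLinOn F hF)
      ⟨{0}, ⟨smoothSeminorm Γ 0 f * (MeasureTheory.volume F).toReal, by positivity⟩, ?_⟩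
    intro φ
    have h := MeasureTheory.norm_setIntegral_le_of_norm_le_const (f := fun x => f x * φ x)
      (C := smoothSeminorm Γ 0 f * smoothSeminorm Γ 0 φ) hF
      (fun x _ => by
        rw [norm_mul]
        exact mul_le_mul (norm_le_smoothSeminorm_zero f x) (norm_le_smoothSeminorm_zero φ x)
          (norm_nonneg _) (apply_nonneg _ _))
    refine h.trans (le_of_eq ?_)
    simp only [Finset.sup_singleton]
    change _ = smoothSeminorm Γ 0 f * (MeasureTheory.volume F).toReal * smoothSeminorm Γ 0 φ
    rw [MeasureTheory.Measure.real]
    ring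

end Smooth

/-! ### The tori `𝕋 = ℝ / 2πℤ` and `𝕋² = ℝ² / (2πℤ)²` -/

/-- The lattice `2πℤ ⊆ ℝ`. -/
def lattice : AddSubgroup ℝ := AddSubgroup.zmultiples (2 * Real.pi)

/-- The lattice `2πℤ × 2πℤ ⊆ ℝ × ℝ`. -/
def lattice2 : AddSubgroup (ℝ × ℝ) := lattice.prod lattice

instance : Cocompact lattice where
  exists_compact := by
    refine ⟨Set.Icc 0 (2 * Real.pi), isCompact_Icc, fun x => ?_⟩
    refine ⟨-toIcoDiv Real.two_pi_pos 0 x • (2 * Real.pi),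
      AddSubgroup.mem_zmultiples_iff.mpr ⟨_, rfl⟩, ?_⟩
    have h := sub_toIcoDiv_zsmul_mem_Ico Real.two_pi_pos 0 x
    rw [zero_add] at h
    rw [neg_smul, ← sub_eq_add_neg]
    exact Set.Ico_subset_Icc_self h

instance : Cocompact lattice2 where
  exists_compact := by
    obtain ⟨K, hK, h⟩ := Cocompact.exists_compact (Γ := lattice)
    refine ⟨K ×ˢ K, hK.prod hK, fun x => ?_⟩
    obtain ⟨a, ha, hxa⟩ := h x.1
    obtain ⟨b, hb, hxb⟩ := h x.2
    exact ⟨(a, b), AddSubgroup.mem_prod.mpr ⟨ha, hb⟩, hxa, hxb⟩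

/-- The distribution on `𝕋` given by `φ ↦ ∫_0^{2π} f φ`. -/
def toDist (f : Smooth lattice) : Dist lattice :=
  f.toDistOn (Set.Ioc 0 (2 * Real.pi)) _root_.measure_Ioc_lt_top

/-- The distribution on `𝕋²` given by `φ ↦ ∫_0^{2π} ∫_0^{2π} f φ`. -/
def toDist2 (f : Smooth lattice2) : Dist lattice2 :=
  f.toDistOn (Set.Ioc 0 (2 * Real.pi) ×ˢ Set.Ioc 0 (2 * Real.pi))
    (by
      rw [MeasureTheory.Measure.volume_eq_prod, MeasureTheory.Measure.prod_prod]
      exact ENNReal.mul_lt_top _root_.measure_Ioc_lt_top _root_.measure_Ioc_lt_top)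

/-- The linear map `f ↦ -i f'` on `C^∞(𝕋)`. -/
def dLin : Smooth lattice →ₗ[ℂ] Smooth lattice where
  toFun f := Smooth.mk (fun x => -Complex.I * deriv f x)
    (contDiff_const.mul ((contDiff_infty_iff_deriv.mp f.contDiff).2))
    (fun γ hγ x => by
      rw [← deriv_comp_add_const]
      congr 2
      funext y
      exact f.periodic hγ y)
  map_add' f g := by
    ext x
    have hf : DifferentiableAt ℝ f x := f.contDiff.differentiable (by simp) x
    have hg : DifferentiableAt ℝ g x := g.contDiff.differentiable (by simp) x
    simp only [Smooth.mk_apply, Smooth.add_apply, Smooth.coe_add, deriv_add hf hg]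
    ring
  map_smul' c f := by
    ext x
    have hf : DifferentiableAt ℝ f x := f.contDiff.differentiable (by simp) x
    simp only [Smooth.mk_apply, Smooth.smul_apply, Smooth.coe_smul, RingHom.id_apply,
      deriv_const_smul c hf, smul_eq_mul]
    ring

/-- The operator `D = -i d/dx` on `C^∞(𝕋)`. -/
def dSmooth : Smooth lattice →L[ℂ] Smooth lattice where
  toLinearMap := dLin
  cont := by
    refine WithSeminorms.continuous_of_isBounded (withSeminorms (Γ := lattice))
      (withSeminorms (Γ := lattice)) dLin
      (fun k => ⟨{k + 1}, 1, fun f => ?_⟩)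
    rw [Finset.sup_singleton, one_smul]
    refine smoothSeminorm_le k _ fun x => ?_
    refine le_trans (le_of_eq ?_) (le_smoothSeminorm (k + 1) f x)
    have hf : ContDiff ℝ ∞ (deriv f) := (contDiff_infty_iff_deriv.mp f.contDiff).2
    change ‖iteratedFDeriv ℝ k ((-Complex.I) • deriv f) x‖ = _
    rw [iteratedFDeriv_const_smul_apply (hf.contDiffAt.of_le (by exact_mod_cast le_top)),
      norm_smul, norm_iteratedFDeriv_eq_norm_iteratedDeriv,
      norm_iteratedFDeriv_eq_norm_iteratedDeriv, iteratedDeriv_succ']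
    simp

/-- The tensor product `(φ ⊗ ψ)(t, x) = φ(t) ψ(x)`, as a linear function of `ψ`. -/
def tensorLin (φ : Smooth lattice) : Smooth lattice →ₗ[ℂ] Smooth lattice2 where
  toFun ψ := Smooth.mk (fun z => φ z.1 * ψ z.2)
    ((φ.contDiff.comp contDiff_fst).mul (ψ.contDiff.comp contDiff_snd))
    (fun γ hγ z => by
      have h := AddSubgroup.mem_prod.mp hγ
      rw [Prod.fst_add, Prod.snd_add, φ.periodic h.1, ψ.periodic h.2])
  map_add' ψ χ := by
    ext z
    simp [mul_add]
  map_smul' c ψ := by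
    ext z
    simp only [Smooth.mk_apply, Smooth.smul_apply, RingHom.id_apply]
    ring

/-- The tensor product `(φ ⊗ ψ)(t, x) = φ(t) ψ(x)`, as a continuous linear function of `ψ`. -/
def tensor (φ : Smooth lattice) : Smooth lattice →L[ℂ] Smooth lattice2 where
  toLinearMap := tensorLin φ
  cont := by
    refine WithSeminorms.continuous_of_isBounded (withSeminorms (Γ := lattice))
      (withSeminorms (Γ := lattice2)) (tensorLin φ)
      (fun k => ⟨Finset.range (k + 1),
        Real.toNNReal (∑ i ∈ Finset.range (k + 1),
          (k.choose i : ℝ) * smoothSeminorm lattice i φ), fun ψ => ?_⟩)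
    set P : Seminorm ℂ (Smooth lattice) :=
      (Finset.range (k + 1)).sup (smoothSeminorms lattice) with hP
    have hPle : ∀ i ∈ Finset.range (k + 1), smoothSeminorm lattice (k - i) ψ ≤ P ψ := by
      intro i _
      have hmem : k - i ∈ Finset.range (k + 1) := by
        rw [Finset.mem_range]
        omega
      exact Finset.le_sup (f := (smoothSeminorms lattice)) hmem ψ
    refine smoothSeminorm_le k _ fun z => ?_
    have h1 : ∀ (i : ℕ), ‖iteratedFDeriv ℝ i (fun z : ℝ × ℝ => φ z.1) z‖
        ≤ smoothSeminorm lattice i φ := by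
      intro i
      have := (ContinuousLinearMap.fst ℝ ℝ ℝ).iteratedFDeriv_comp_right (i := i) (f := φ)
        φ.contDiff z (by exact_mod_cast le_top)
      change ‖iteratedFDeriv ℝ i (φ ∘ ContinuousLinearMap.fst ℝ ℝ ℝ) z‖ ≤ _
      rw [this]
      refine (ContinuousMultilinearMap.norm_compContinuousLinearMap_le _ _).trans ?_
      refine (mul_le_of_le_one_right (norm_nonneg _) ?_).trans (le_smoothSeminorm i φ z.1)
      exact Finset.prod_le_one (fun _ _ => norm_nonneg _)
        (fun _ _ => ContinuousLinearMap.norm_fst_le ℝ ℝ ℝ)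
    have h2 : ∀ (i : ℕ), ‖iteratedFDeriv ℝ i (fun z : ℝ × ℝ => ψ z.2) z‖
        ≤ smoothSeminorm lattice i ψ := by
      intro i
      have := (ContinuousLinearMap.snd ℝ ℝ ℝ).iteratedFDeriv_comp_right (i := i) (f := ψ)
        ψ.contDiff z (by exact_mod_cast le_top)
      change ‖iteratedFDeriv ℝ i (ψ ∘ ContinuousLinearMap.snd ℝ ℝ ℝ) z‖ ≤ _
      rw [this]
      refine (ContinuousMultilinearMap.norm_compContinuousLinearMap_le _ _).trans ?_
      refine (mul_le_of_le_one_right (norm_nonneg _) ?_).trans (le_smoothSeminorm i ψ z.2)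
      exact Finset.prod_le_one (fun _ _ => norm_nonneg _)
        (fun _ _ => ContinuousLinearMap.norm_snd_le ℝ ℝ ℝ)
    refine (norm_iteratedFDeriv_mul_le (φ.contDiff.comp contDiff_fst)
      (ψ.contDiff.comp contDiff_snd) z (n := k) (by exact_mod_cast le_top)).trans ?_
    change _ ≤ (Real.toNNReal (∑ i ∈ Finset.range (k + 1),
      (k.choose i : ℝ) * smoothSeminorm lattice i φ) : ℝ) * P ψ
    rw [Real.coe_toNNReal _ (Finset.sum_nonneg fun i _ => by positivity), Finset.sum_mul]
    refine Finset.sum_le_sum fun i hi => ?_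
    refine mul_le_mul (mul_le_mul_of_nonneg_left (h1 i) (Nat.cast_nonneg _))
      ((h2 (k - i)).trans (hPle i hi)) (norm_nonneg _) (by positivity)

/-- The partial pairing `⟨u(t, x), φ(t)⟩`, a distribution in `x`, of a distribution `u` on `𝕋²`
with a test function `φ` in the variable `t`. -/
def slice (u : Dist lattice2) (φ : Smooth lattice) : Dist lattice := u.comp (tensor φ)

/-- Continuous linear operators `D'(𝕋) → D'(𝕋)`. -/
abbrev Op : Type := Dist lattice →L[ℂ] Dist lattice

/-- The operator `D_x = -i d/dx` on `D'(𝕋)`: `⟨D_x u, φ⟩ = -⟨u, D_x φ⟩`. -/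
def Dx : Op := -ContinuousLinearMap.precomp ℂ dSmooth

/-- The elliptic operator `E = D_x² = -d²/dx²` on `D'(𝕋)`. -/
def Lap : Op := Dx.comp Dx

/-! ### Operators invariant with respect to `E`, their symbol and their order -/

/-- The domain of the adjoint `A*` contains `C^∞(𝕋)`: for every `φ ∈ C^∞(𝕋)` there is
`ψ = A* φ ∈ C^∞(𝕋)` with `(A u, φ) = (u, ψ)` for all `u`, where `(u, φ) = ⟨u, conj φ⟩`. -/
def AdjointContainsSmooth (A : Op) : Prop :=
  ∀ φ : Smooth lattice, ∃ ψ : Smooth lattice, ∀ u : Dist lattice, A u φ.conj = u ψ.conj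

/-- `A` is (strongly) invariant with respect to `E = -d²/dx²`. -/
structure EInvariant (A : Op) : Prop where
  adjoint : AdjointContainsSmooth A
  commute : A.comp Lap = Lap.comp A

/-- The exponential `x ↦ e^{inx}`. -/
def expo (n : ℤ) : Smooth lattice :=
  Smooth.mk (fun x : ℝ => Complex.exp (Complex.I * n * x))
    (Complex.contDiff_exp.comp (contDiff_const.mul Complex.ofRealCLM.contDiff))
    (fun γ hγ x => by
      obtain ⟨m, rfl⟩ := AddSubgroup.mem_zmultiples_iff.mp hγ
      refine Complex.exp_eq_exp_iff_exists_int.mpr ⟨n * m, ?_⟩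
      push_cast [zsmul_eq_mul]
      ring)

/-- The Fourier coefficient `(2π)⁻¹ ⟨u, e^{-inx}⟩`. -/
def fourierAt (u : Dist lattice) (n : ℤ) : ℂ := (2 * (Real.pi : ℂ))⁻¹ * u (expo (-n))

/-- The frequencies of the basis `e_j^1 = e^{-ijx}`, `e_j^2 = e^{ijx}` of the eigenspace of `E` for
the eigenvalue `j²`. -/
def freq (j : ℕ) : Fin 2 → ℤ := ![-(j : ℤ), (j : ℤ)]

/-- The matrix symbol of `A`: for `j ≥ 1`, the matrix of `A` on the eigenspace of `E` for the
eigenvalue `j²` in the basis `e^{-ijx}, e^{ijx}`; column `l` holds the coefficients of `A e_j^l`.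
For `j = 0`, where the eigenspace is one-dimensional, all four entries equal the single entry of
the symbol. -/
def symbol (A : Op) (j : ℕ) : Matrix (Fin 2) (Fin 2) ℂ :=
  Matrix.of fun k l => fourierAt (A (toDist (expo (freq j l)))) (freq j k)

/-- The symbol of `A` is bounded by a multiple of `j ^ N` for large `j`. -/
def SymbolGrowth (A : Op) (N : ℝ) : Prop :=
  ∃ C : ℝ, 0 < C ∧ ∃ j₀ : ℕ, ∀ j : ℕ, 1 ≤ j → j₀ ≤ j →
    ∀ k l : Fin 2, ‖symbol A j k l‖ ≤ C * (j : ℝ) ^ N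

/-- The order of `A`: the infimum of the exponents `N` for which the symbol is `O(j ^ N)`. -/
def order (A : Op) : EReal := sInf {N : EReal | ∃ r : ℝ, N = r ∧ SymbolGrowth A r}

/-! ### Global hypoellipticity of `D_t + Q` on `𝕋²` -/

/-- `v = (D_t + Q) u` for distributions `u`, `v` on `𝕋²`, with `Q` acting in the variable `x`: for
every test function `φ(t)`, `⟨v, φ⟩ = -⟨u, D_t φ⟩ + Q ⟨u, φ⟩` in `D'(𝕋)`. As the functions
`φ(t) ψ(x)` span a dense subspace of `C^∞(𝕋²)`, this determines `v`. -/
def IsImage (Q : Op) (u v : Dist lattice2) : Prop :=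
  ∀ φ : Smooth lattice, slice v φ = -slice u (dSmooth φ) + Q (slice u φ)

/-- The distribution `u` on `𝕋²` is a smooth function. -/
def IsSmooth (u : Dist lattice2) : Prop := ∃ g : Smooth lattice2, u = toDist2 g

/-- `D_t + Q` is globally hypoelliptic: if `u ∈ D'(𝕋²)` and `(D_t + Q) u ∈ C^∞(𝕋²)`, then
`u ∈ C^∞(𝕋²)`. -/
def GloballyHypoelliptic (Q : Op) : Prop :=
  ∀ u v : Dist lattice2, IsImage Q u v → IsSmooth v → IsSmooth u

end

end TorusGH

open scoped ContDiff

namespace TorusGH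

noncomputable section

section General

variable {E : Type*} [NormedAddCommGroup E] [NormedSpace ℝ E] {Γ : AddSubgroup E}

/-! If `Q` preserves each span of `e^{-ijx}`, `e^{ijx}` and has there an eigenvector `P_j` with an
integer eigenvalue `-m_j`, then every `e^{i m_j t} P_j` is annihilated by `D_t + Q`. Normalising
`P_j` to have coefficients of total size `1/j²` makes the sum over `j` converge uniformly. The sum
is a solution of the homogeneous equation whose Fourier coefficients decay only polynomially, so it
is not smooth (`not_globallyHypoelliptic`). The size of `m_j` plays no role, because decay in the
frequency of `x` alone is violated.

Both perturbations push an eigenvalue of `α D_x` to an integer for every `j`. In the commutative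
case `r_j = -fract (α j)`, so that `e^{ijx}` gets the eigenvalue `⌊α j⌋`; this symbol is even
bounded. In the non-commutative case the matrix with rows `(-α j, γ_j)` and `(γ_j, α j)` has
eigenvalues `±√(α² j² + γ_j²)`, and `γ_j` is chosen to make the root equal to `⌈|α j|⌉`. The gap
between `|α j|²` and `⌈|α j|⌉²` is at most `2|α| j + 1`, whence `γ_j = O(j^{1/2})`.

Both operators are transposes of Fourier multipliers on smooth functions, composed with a reflection
of the circle in the second case. The reflection anticommutes with `D_x`, hence commutes with
`D_x²`: this gives invariance under `E` without commutation with `D_x`. -/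

theorem Smooth.conj_conj (f : Smooth Γ) : f.conj.conj = f := by
  ext x
  exact Complex.conj_conj (f x)

/-- The transpose of any continuous operator on smooth functions has an adjoint whose domain
contains the smooth functions. -/
theorem adjointContainsSmooth_precomp (T : Smooth lattice →L[ℂ] Smooth lattice) :
    AdjointContainsSmooth (ContinuousLinearMap.precomp ℂ T) := fun φ =>
  ⟨(T φ.conj).conj, fun u => by rw [Smooth.conj_conj]; rfl⟩

end General

/-! ### The bilinear pairing on the circle and integration by parts. -/

theorem toDist_apply (f φ : Smooth lattice) :
    toDist f φ = ∫ x in (0 : ℝ)..(2 * Real.pi), f x * φ x := by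
  rw [intervalIntegral.integral_of_le Real.two_pi_pos.le]
  rfl

/-- Symmetry lets linearity in the density be read off from linearity in the test function. -/
theorem toDist_comm (f φ : Smooth lattice) : toDist f φ = toDist φ f := by
  simp only [toDist_apply, mul_comm]

theorem toDist_add (f g : Smooth lattice) : toDist (f + g) = toDist f + toDist g := by
  ext φ
  rw [toDist_comm, map_add, toDist_comm, toDist_comm φ g]
  rfl

theorem toDist_smul (c : ℂ) (f : Smooth lattice) : toDist (c • f) = c • toDist f := by
  ext φ
  rw [toDist_comm, map_smul, toDist_comm]
  rfl

theorem norm_toDist_apply_le (f φ : Smooth lattice) :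
    ‖toDist f φ‖ ≤ 2 * Real.pi * (smoothSeminorm lattice 0 f * smoothSeminorm lattice 0 φ) := by
  rw [toDist_apply]
  refine (intervalIntegral.norm_integral_le_of_norm_le_const
    (C := smoothSeminorm lattice 0 f * smoothSeminorm lattice 0 φ) fun x _ => ?_).trans_eq ?_
  · rw [norm_mul]
    exact mul_le_mul (norm_le_smoothSeminorm_zero f x) (norm_le_smoothSeminorm_zero φ x)
      (norm_nonneg _) (apply_nonneg _ _)
  · rw [sub_zero, abs_of_pos Real.two_pi_pos, mul_comm]

theorem dSmooth_apply (f : Smooth lattice) (x : ℝ) : dSmooth f x = -Complex.I * deriv f x := rfl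

theorem Smooth.hasDerivAt (f : Smooth lattice) (x : ℝ) : HasDerivAt f (Complex.I * dSmooth f x) x := by
  have h := (f.contDiff.differentiable (by simp) x).hasDerivAt
  have he : Complex.I * dSmooth f x = deriv f x := by
    rw [dSmooth_apply, ← mul_assoc]
    simp
  rwa [he]

theorem two_pi_mem_lattice : 2 * Real.pi ∈ lattice := AddSubgroup.mem_zmultiples _

theorem integral_dSmooth (f : Smooth lattice) :
    ∫ x in (0 : ℝ)..(2 * Real.pi), dSmooth f x = 0 := by
  have h := intervalIntegral.integral_eq_sub_of_hasDerivAt (a := 0) (b := 2 * Real.pi)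
    (fun x _ => f.hasDerivAt x)
    ((continuous_const.mul (dSmooth f).contDiff.continuous).intervalIntegrable _ _)
  have hp := f.periodic two_pi_mem_lattice 0
  rw [zero_add] at hp
  rw [hp, sub_self, intervalIntegral.integral_const_mul] at h
  exact (mul_eq_zero.mp h).resolve_left Complex.I_ne_zero

/-- The pointwise product of smooth functions. -/
def Smooth.mul (f g : Smooth lattice) : Smooth lattice :=
  Smooth.mk (fun x => f x * g x) (f.contDiff.mul g.contDiff)
    (fun γ hγ x => by rw [f.periodic hγ, g.periodic hγ])

theorem dSmooth_mul (f g : Smooth lattice) (x : ℝ) :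
    dSmooth (f.mul g) x = dSmooth f x * g x + f x * dSmooth g x := by
  have h := (f.hasDerivAt x).mul (g.hasDerivAt x)
  have h' := h.unique ((f.mul g).hasDerivAt x)
  apply mul_left_cancel₀ Complex.I_ne_zero
  rw [← h']
  ring

/-- Integration by parts. -/
theorem toDist_dSmooth (f φ : Smooth lattice) : toDist f (dSmooth φ) = -toDist (dSmooth f) φ := by
  have h := integral_dSmooth (f.mul φ)
  simp only [dSmooth_mul] at h
  rw [intervalIntegral.integral_add (f := fun x => dSmooth f x * φ x)
    (g := fun x => f x * dSmooth φ x)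
    (((dSmooth f).contDiff.continuous.mul φ.contDiff.continuous).intervalIntegrable _ _)
    ((f.contDiff.continuous.mul (dSmooth φ).contDiff.continuous).intervalIntegrable _ _)] at h
  rw [toDist_apply, toDist_apply]
  exact eq_neg_of_add_eq_zero_right h

theorem Dx_toDist (f : Smooth lattice) : Dx (toDist f) = toDist (dSmooth f) := by
  ext φ
  change -(toDist f (dSmooth φ)) = _
  rw [toDist_dSmooth, neg_neg]

/-! ### Exponentials, orthogonality and decay of Fourier coefficients. -/

theorem expo_apply (n : ℤ) (x : ℝ) : expo n x = Complex.exp (Complex.I * n * x) := rfl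

theorem norm_expo_apply (n : ℤ) (x : ℝ) : ‖expo n x‖ = 1 := by
  rw [expo_apply, show Complex.I * n * x = ((n * x : ℝ) : ℂ) * Complex.I by push_cast; ring]
  exact Complex.norm_exp_ofReal_mul_I _

theorem dSmooth_expo (n : ℤ) : dSmooth (expo n) = (n : ℂ) • expo n := by
  ext x
  have h : HasDerivAt (expo n) (expo n x * (Complex.I * n)) x := by
    have h1 : HasDerivAt (fun x : ℝ => Complex.I * n * (x : ℂ)) (Complex.I * n) x := by
      simpa using (Complex.ofRealCLM.hasDerivAt (x := x)).const_mul (Complex.I * n)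
    exact h1.cexp
  have h' := h.unique ((expo n).hasDerivAt x)
  apply mul_left_cancel₀ Complex.I_ne_zero
  rw [← h', Smooth.smul_apply]
  ring

theorem norm_iteratedFDeriv_dSmooth (f : Smooth lattice) (k : ℕ) (x : ℝ) :
    ‖iteratedFDeriv ℝ k (dSmooth f) x‖ = ‖iteratedFDeriv ℝ (k + 1) f x‖ := by
  have hf : ContDiff ℝ ∞ (deriv f) := (contDiff_infty_iff_deriv.mp f.contDiff).2
  change ‖iteratedFDeriv ℝ k ((-Complex.I) • deriv f) x‖ = _
  rw [iteratedFDeriv_const_smul_apply (hf.contDiffAt.of_le (by exact_mod_cast le_top)),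
    norm_smul, norm_iteratedFDeriv_eq_norm_iteratedDeriv,
    norm_iteratedFDeriv_eq_norm_iteratedDeriv, iteratedDeriv_succ']
  simp

theorem smoothSeminorm_dSmooth (f : Smooth lattice) (k : ℕ) :
    smoothSeminorm lattice k (dSmooth f) = smoothSeminorm lattice (k + 1) f :=
  congrArg iSup (funext fun x => norm_iteratedFDeriv_dSmooth f k x)

theorem smoothSeminorm_zero_expo_le (n : ℤ) : smoothSeminorm lattice 0 (expo n) ≤ 1 :=
  smoothSeminorm_le 0 _ fun x => by simp [norm_expo_apply]

theorem smoothSeminorm_expo_le (n : ℤ) (k : ℕ) :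
    smoothSeminorm lattice k (expo n) ≤ |(n : ℝ)| ^ k := by
  induction k with
  | zero => simpa using smoothSeminorm_zero_expo_le n
  | succ k ih =>
    rw [← smoothSeminorm_dSmooth, dSmooth_expo, map_smul_eq_mul, pow_succ']
    simpa using mul_le_mul_of_nonneg_left ih (abs_nonneg (n : ℝ))

/-- For `m + n ≠ 0`, integration by parts shows that the pairing is killed by the factor `m + n`.
The pairing is bilinear, without conjugation, so opposite frequencies are the ones that match. -/
theorem toDist_expo_expo (m n : ℤ) :
    toDist (expo m) (expo n) = if m + n = 0 then 2 * (Real.pi : ℂ) else 0 := by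
  split_ifs with h
  · have : ∀ x : ℝ, expo m x * expo n x = 1 := fun x => by
      obtain rfl : n = -m := by omega
      rw [expo_apply, expo_apply, ← Complex.exp_add, ← Complex.exp_zero]
      congr 1
      push_cast
      ring
    simp [toDist_apply, this]
  · have h1 := toDist_dSmooth (expo m) (expo n)
    rw [dSmooth_expo, dSmooth_expo, map_smul, toDist_smul, _root_.smul_apply,
      smul_eq_mul, smul_eq_mul, eq_neg_iff_add_eq_zero, ← add_mul] at h1
    refine (mul_eq_zero.mp h1).resolve_left fun h2 => h ?_
    rw [add_comm]
    exact_mod_cast h2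

/-- Fourier coefficients of smooth functions decay faster than any power. -/
theorem norm_toDist_expo_mul_pow_le (f : Smooth lattice) (n : ℤ) (k : ℕ) :
    ‖toDist f (expo n)‖ * |(n : ℝ)| ^ k ≤ 2 * Real.pi * smoothSeminorm lattice k f := by
  induction k generalizing f with
  | zero =>
    rw [pow_zero, mul_one]
    refine (norm_toDist_apply_le f (expo n)).trans ?_
    gcongr
    exact mul_le_of_le_one_right (apply_nonneg _ _) (smoothSeminorm_zero_expo_le n)
  | succ k ih =>
    -- One integration by parts trades a factor `n` for a derivative of `f`.
    have h := ih (dSmooth f)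
    rw [smoothSeminorm_dSmooth] at h
    refine le_trans (le_of_eq ?_) h
    have h1 := toDist_dSmooth f (expo n)
    rw [dSmooth_expo, map_smul, smul_eq_mul] at h1
    have h2 := congrArg norm h1
    rw [norm_mul, norm_neg] at h2
    rw [← h2]
    simp
    ring

/-- The coefficient of `expo n` in the Fourier series of a smooth function. -/
def coeff (f : Smooth lattice) (n : ℤ) : ℂ := fourierAt (toDist f) n

theorem coeff_add (f g : Smooth lattice) (n : ℤ) : coeff (f + g) n = coeff f n + coeff g n := by
  simp [coeff, fourierAt, toDist_add, mul_add]

theorem coeff_smul (c : ℂ) (f : Smooth lattice) (n : ℤ) : coeff (c • f) n = c * coeff f n := by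
  simp only [coeff, fourierAt, toDist_smul, _root_.smul_apply, smul_eq_mul]
  ring

theorem toDist_expo (n : ℤ) (f : Smooth lattice) :
    toDist (expo n) f = 2 * (Real.pi : ℂ) * coeff f (-n) := by
  have : (Real.pi : ℂ) ≠ 0 := by exact_mod_cast Real.pi_ne_zero
  rw [coeff, fourierAt, neg_neg, toDist_comm]
  field_simp

theorem coeff_dSmooth (f : Smooth lattice) (n : ℤ) : coeff (dSmooth f) n = n * coeff f n := by
  have h1 := toDist_dSmooth f (expo (-n))
  rw [dSmooth_expo, map_smul, smul_eq_mul] at h1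
  rw [coeff, coeff, fourierAt, fourierAt, ← neg_eq_iff_eq_neg.mpr h1]
  push_cast
  ring

theorem norm_coeff_mul_pow_le (f : Smooth lattice) (n : ℤ) (k : ℕ) :
    ‖coeff f n‖ * |(n : ℝ)| ^ k ≤ smoothSeminorm lattice k f := by
  have h := norm_toDist_expo_mul_pow_le f (-n) k
  have hπ := Real.pi_pos
  rw [Int.cast_neg, abs_neg] at h
  rw [coeff, fourierAt, norm_mul]
  have : ‖(2 * (Real.pi : ℂ))⁻¹‖ = (2 * Real.pi)⁻¹ := by
    simp [abs_of_pos hπ]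
  rw [this, mul_assoc, inv_mul_le_iff₀ (by positivity)]
  exact h


/-! ### Smooth functions from rapidly decaying Fourier series. -/

/-- A sequence on `ℤ` that decays faster than any power. -/
def RapidDecay (b : ℤ → ℂ) : Prop := ∀ k : ℕ, Summable fun n => ‖b n‖ * |(n : ℝ)| ^ k

theorem RapidDecay.norm_le {b : ℤ → ℂ} (k : ℕ) (n : ℤ) (x : ℝ) :
    ‖iteratedFDeriv ℝ k (⇑(b n • expo n)) x‖ ≤ ‖b n‖ * |(n : ℝ)| ^ k := by
  refine (le_smoothSeminorm k _ x).trans ?_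
  rw [map_smul_eq_mul]
  exact mul_le_mul_of_nonneg_left (smoothSeminorm_expo_le n k) (norm_nonneg _)

/-- The smooth function with rapidly decaying Fourier coefficients `b`. -/
def ofCoeff (b : ℤ → ℂ) (hb : RapidDecay b) : Smooth lattice :=
  Smooth.mk (fun x => ∑' n, (b n • expo n) x)
    (contDiff_tsum (fun n => (b n • expo n).contDiff) (fun k _ => hb k)
      fun k n x _ => RapidDecay.norm_le k n x)
    (fun γ hγ x => by simp only [Smooth.periodic _ hγ])

theorem ofCoeff_apply (b : ℤ → ℂ) (hb : RapidDecay b) (x : ℝ) :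
    ofCoeff b hb x = ∑' n, (b n • expo n) x := rfl

theorem RapidDecay.summable_norm {b : ℤ → ℂ} (hb : RapidDecay b) : Summable fun n => ‖b n‖ := by
  simpa using hb 0

theorem RapidDecay.hasSum {b : ℤ → ℂ} (hb : RapidDecay b) (x : ℝ) :
    HasSum (fun n => (b n • expo n) x) (ofCoeff b hb x) := by
  refine (Summable.of_norm ?_).hasSum
  simpa [norm_expo_apply] using hb.summable_norm

theorem smoothSeminorm_ofCoeff_le (b : ℤ → ℂ) (hb : RapidDecay b) (k : ℕ) :
    smoothSeminorm lattice k (ofCoeff b hb) ≤ ∑' n, ‖b n‖ * |(n : ℝ)| ^ k := by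
  refine smoothSeminorm_le k _ fun x => ?_
  have h := iteratedFDeriv_tsum_apply (𝕜 := ℝ) (f := fun n : ℤ => ⇑(b n • expo n)) (N := ⊤)
    (fun n => (b n • expo n).contDiff) (fun k _ => hb k)
    (fun k n x _ => RapidDecay.norm_le k n x) (k := k) (by exact_mod_cast le_top) x
  change ‖iteratedFDeriv ℝ k (fun x => ∑' n, (b n • expo n) x) x‖ ≤ _
  rw [h]
  exact tsum_of_norm_bounded (hb k).hasSum fun n => RapidDecay.norm_le k n x

theorem RapidDecay.int_mul {b : ℤ → ℂ} (hb : RapidDecay b) : RapidDecay fun n => n * b n := by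
  intro k
  refine (hb (k + 1)).congr fun n => ?_
  rw [norm_mul, Complex.norm_intCast, pow_succ]
  ring

theorem dSmooth_ofCoeff (b : ℤ → ℂ) (hb : RapidDecay b) :
    dSmooth (ofCoeff b hb) = ofCoeff (fun n => n * b n) hb.int_mul := by
  ext x
  have h : HasDerivAt (fun x => ∑' n, (b n • expo n) x)
      (∑' n, Complex.I * dSmooth (b n • expo n) x) x := by
    refine hasDerivAt_tsum (hb 1) (fun n y => (b n • expo n).hasDerivAt y) (fun n y => ?_)
      (hb.hasSum x).summable x
    rw [map_smul, dSmooth_expo]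
    simp [norm_expo_apply]
  have h' := h.unique ((ofCoeff b hb).hasDerivAt x)
  rw [tsum_mul_left] at h'
  rw [← mul_left_cancel₀ Complex.I_ne_zero h', ofCoeff_apply]
  congr 1
  funext n
  rw [map_smul, dSmooth_expo]
  simp only [Smooth.smul_apply]
  ring

theorem toDist_expo_ofCoeff (b : ℤ → ℂ) (hb : RapidDecay b) (m : ℤ) :
    toDist (expo m) (ofCoeff b hb) = 2 * (Real.pi : ℂ) * b (-m) := by
  -- Term-by-term integration, dominated by the summable `‖b n‖`; orthogonality then leaves the
  -- single term `n = -m`.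
  have h := intervalIntegral.hasSum_integral_of_dominated_convergence
    (μ := MeasureTheory.volume) (a := 0) (b := 2 * Real.pi)
    (F := fun (n : ℤ) x => expo m x * (b n • expo n) x)
    (f := fun x => expo m x * ofCoeff b hb x) (fun n _ => ‖b n‖)
    (fun n => ((expo m).contDiff.continuous.mul
      (b n • expo n).contDiff.continuous).aestronglyMeasurable)
    (fun n => Filter.Eventually.of_forall fun x _ => by simp [norm_expo_apply])
    (Filter.Eventually.of_forall fun x _ => hb.summable_norm)
    (by simp) (Filter.Eventually.of_forall fun x _ => (hb.hasSum x).mul_left _)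
  simp only [← toDist_apply, map_smul] at h
  refine h.unique ?_
  convert hasSum_single (-m) ?_ using 1
  · rw [toDist_expo_expo, if_pos (by omega), smul_eq_mul, mul_comm]
  · intro n hn
    rw [toDist_expo_expo, if_neg (by omega), smul_zero]

/-! ### Fourier multipliers with reflection, and their matrix symbols. -/

section Multiplier

/-- Sequences of at most linear growth that vanish at `0`. -/
def LinearGrowth (a : ℤ → ℂ) : Prop := ∃ C : ℝ, 0 ≤ C ∧ ∀ n, ‖a n‖ ≤ C * |(n : ℝ)|

variable {a : ℤ → ℂ} (ε : ℤˣ)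

theorem abs_units_mul (n : ℤ) : |(((ε : ℤ) * n : ℤ) : ℝ)| = |(n : ℝ)| := by
  rcases Int.units_eq_one_or ε with rfl | rfl <;> simp

/-- Of the three extra derivatives, one pays for the linear growth of `a` and two produce the
summable factor `1/n²`. -/
theorem norm_multiplier_mul_pow_le {C : ℝ} (hC : 0 ≤ C) (ha : ∀ n, ‖a n‖ ≤ C * |(n : ℝ)|)
    (f : Smooth lattice) (k : ℕ) (n : ℤ) :
    ‖a n * coeff f (ε * n)‖ * |(n : ℝ)| ^ k
      ≤ C * smoothSeminorm lattice (k + 3) f * (1 / (n : ℝ) ^ 2) := by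
  rcases eq_or_ne n 0 with rfl | hn
  -- The growth bound forces `a 0 = 0`, which is consistent with the convention `1/0 = 0` on the
  -- right-hand side.
  · have := ha 0
    have h0 : a 0 = 0 := by simpa using this
    simp [h0]
  have hn' : 0 < |(n : ℝ)| := by simpa using hn
  have h := norm_coeff_mul_pow_le f (ε * n) (k + 3)
  rw [abs_units_mul] at h
  rw [mul_one_div, le_div_iff₀ (by positivity), ← sq_abs (n : ℝ), norm_mul]
  calc ‖a n‖ * ‖coeff f (ε * n)‖ * |(n : ℝ)| ^ k * |(n : ℝ)| ^ 2
      ≤ C * |(n : ℝ)| * ‖coeff f (ε * n)‖ * |(n : ℝ)| ^ k * |(n : ℝ)| ^ 2 := by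
        gcongr
        exact ha n
    _ = C * (‖coeff f (ε * n)‖ * |(n : ℝ)| ^ (k + 3)) := by ring
    _ ≤ _ := by gcongr

theorem LinearGrowth.rapidDecay (ha : LinearGrowth a) (f : Smooth lattice) :
    RapidDecay fun n => a n * coeff f (ε * n) := by
  obtain ⟨C, hC, ha⟩ := ha
  intro k
  exact Summable.of_nonneg_of_le (fun n => by positivity)
    (norm_multiplier_mul_pow_le ε hC ha f k)
    ((Real.summable_one_div_int_pow.mpr one_lt_two).mul_left _)

/-- The Fourier multiplier with symbol `a`, composed with the reflection `x ↦ ε x`. -/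
def multiplierLin (ha : LinearGrowth a) : Smooth lattice →ₗ[ℂ] Smooth lattice where
  toFun f := ofCoeff _ (ha.rapidDecay ε f)
  map_add' f g := by
    ext x
    rw [Smooth.add_apply]
    refine ((ha.rapidDecay ε (f + g)).hasSum x).unique ?_
    convert ((ha.rapidDecay ε f).hasSum x).add ((ha.rapidDecay ε g).hasSum x) using 1
    funext n
    simp only [Smooth.smul_apply, coeff_add]
    ring
  map_smul' c f := by
    ext x
    rw [RingHom.id_apply, Smooth.smul_apply]
    have h := ((ha.rapidDecay ε f).hasSum x).mul_left c
    have he : ∀ n : ℤ, c * ((a n * coeff f (ε * n)) • expo n) x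
        = ((a n * coeff (c • f) (ε * n)) • expo n) x := fun n => by
      simp only [Smooth.smul_apply, coeff_smul]
      ring
    simp only [he] at h
    exact ((ha.rapidDecay ε (c • f)).hasSum x).unique h

/-- The Fourier multiplier with symbol `a`, composed with the reflection `x ↦ ε x`. -/
def multiplier (ha : LinearGrowth a) : Smooth lattice →L[ℂ] Smooth lattice where
  toLinearMap := multiplierLin ε ha
  cont := by
    obtain ⟨C, hC, haC⟩ := id ha
    have hs := Real.summable_one_div_int_pow.mpr one_lt_two
    have hs0 : 0 ≤ ∑' n : ℤ, 1 / (n : ℝ) ^ 2 := tsum_nonneg fun n => by positivity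
    refine WithSeminorms.continuous_of_isBounded (withSeminorms (Γ := lattice))
      (withSeminorms (Γ := lattice)) (multiplierLin ε ha)
      (fun k => ⟨{k + 3}, ⟨C * ∑' n : ℤ, 1 / (n : ℝ) ^ 2, by positivity⟩, fun f => ?_⟩)
    rw [Finset.sup_singleton]
    change smoothSeminorm lattice k (ofCoeff _ (ha.rapidDecay ε f))
      ≤ C * (∑' n : ℤ, 1 / (n : ℝ) ^ 2) * smoothSeminorm lattice (k + 3) f
    refine (smoothSeminorm_ofCoeff_le _ _ k).trans ?_
    rw [mul_right_comm, ← tsum_mul_left]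
    exact (ha.rapidDecay ε f k).tsum_le_tsum (norm_multiplier_mul_pow_le ε hC haC f k)
      (hs.mul_left _)

theorem multiplier_apply (ha : LinearGrowth a) (f : Smooth lattice) :
    multiplier ε ha f = ofCoeff _ (ha.rapidDecay ε f) := rfl

theorem dSmooth_multiplier (ha : LinearGrowth a) (f : Smooth lattice) :
    dSmooth (multiplier ε ha f) = ((ε : ℤ) : ℂ) • multiplier ε ha (dSmooth f) := by
  rw [multiplier_apply, dSmooth_ofCoeff, ← map_smul, multiplier_apply]
  congr 1
  funext n
  rw [coeff_smul, coeff_dSmooth]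
  have h : ((ε : ℤ) : ℂ) * ((ε : ℤ) : ℂ) = 1 := by
    rcases Int.units_eq_one_or ε with rfl | rfl <;> simp
  push_cast
  linear_combination (-(n : ℂ) * a n * coeff f (ε * n)) * h

/-- The operator on distributions with `e_n ↦ a n • e_{ε n}`, for even `a`. -/
def multiplierOp (ha : LinearGrowth a) : Op := ContinuousLinearMap.precomp ℂ (multiplier ε ha)

theorem multiplierOp_apply (ha : LinearGrowth a) (u : Dist lattice) (f : Smooth lattice) :
    multiplierOp ε ha u f = u (multiplier ε ha f) := rfl

theorem Dx_apply (u : Dist lattice) (f : Smooth lattice) : Dx u f = -u (dSmooth f) := rfl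

/-- A multiplier commutes with `D_x`, while the reflection `x ↦ -x` reverses its sign; `ε² = 1`
moves the sign across the transpose. -/
theorem Dx_multiplierOp (ha : LinearGrowth a) (u : Dist lattice) :
    Dx (multiplierOp ε ha u) = ((ε : ℤ) : ℂ) • multiplierOp ε ha (Dx u) := by
  ext f
  have h : ((ε : ℤ) : ℂ) * ((ε : ℤ) : ℂ) = 1 := by
    rcases Int.units_eq_one_or ε with rfl | rfl <;> simp
  rw [_root_.smul_apply, multiplierOp_apply, Dx_apply, Dx_apply, multiplierOp_apply,
    dSmooth_multiplier, map_smul, smul_eq_mul, smul_eq_mul]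
  linear_combination (u (multiplier ε ha (dSmooth f))) * h

/-- Moving past `D_x` twice costs the sign `ε² = 1`, so `D_x²` commutes even in the reflected case.
-/
theorem eInvariant_multiplierOp (ha : LinearGrowth a) : EInvariant (multiplierOp ε ha) where
  adjoint := adjointContainsSmooth_precomp _
  commute := by
    ext u : 1
    have h : ((ε : ℤ) : ℂ) * ((ε : ℤ) : ℂ) = 1 := by
      rcases Int.units_eq_one_or ε with rfl | rfl <;> simp
    change multiplierOp ε ha (Dx (Dx u)) = Dx (Dx (multiplierOp ε ha u))
    rw [Dx_multiplierOp, map_smul, Dx_multiplierOp, smul_smul, h, one_smul]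

/-- Transposition reverses frequencies, so the factor that appears is `a (-n)`; evenness turns it
into `a n`. -/
theorem multiplierOp_expo (ha : LinearGrowth a) (heven : ∀ n, a (-n) = a n) (n : ℤ) :
    multiplierOp ε ha (toDist (expo n)) = a n • toDist (expo (ε * n)) := by
  ext f
  rw [multiplierOp_apply, multiplier_apply, toDist_expo_ofCoeff, _root_.smul_apply, toDist_expo,
    heven, mul_neg, smul_eq_mul]
  ring

theorem symbol_multiplierOp (ha : LinearGrowth a) (heven : ∀ n, a (-n) = a n) (j : ℕ)
    (k l : Fin 2) :
    symbol (multiplierOp ε ha) j k l = if ε * freq j l = freq j k then a j else 0 := by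
  have hπ : (Real.pi : ℂ) ≠ 0 := by exact_mod_cast Real.pi_ne_zero
  have haf : a (freq j l) = a j := by
    fin_cases l
    · exact heven j
    · rfl
  rw [symbol, Matrix.of_apply, multiplierOp_expo ε ha heven, fourierAt, _root_.smul_apply,
    toDist_expo_expo, haf]
  by_cases h : ε * freq j l = freq j k
  · rw [if_pos h, if_pos (by omega), smul_eq_mul]
    field_simp
  · rw [if_neg h, if_neg (by omega), smul_zero, mul_zero]

theorem symbol_multiplierOp_zero (ha : LinearGrowth a) (heven : ∀ n, a (-n) = a n) :
    symbol (multiplierOp ε ha) 0 = 0 := by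
  obtain ⟨C, hC, haC⟩ := id ha
  have h0 : a 0 = 0 := by simpa using haC 0
  ext k l
  rw [symbol_multiplierOp ε ha heven]
  simp [h0]

/-- For `j ≥ 1` the frequencies `-j` and `j` differ, so the sign `ε` decides between a diagonal and
an off-diagonal symbol. -/
theorem symbol_multiplierOp_one (ha : LinearGrowth a) (heven : ∀ n, a (-n) = a n) {j : ℕ}
    (hj : 1 ≤ j) : symbol (multiplierOp 1 ha) j = !![a j, 0; 0, a j] := by
  ext k l
  rw [symbol_multiplierOp 1 ha heven]
  fin_cases k <;> fin_cases l <;> simp [freq] <;> omega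

theorem symbol_multiplierOp_neg_one (ha : LinearGrowth a) (heven : ∀ n, a (-n) = a n) {j : ℕ}
    (hj : 1 ≤ j) : symbol (multiplierOp (-1) ha) j = !![0, a j; a j, 0] := by
  ext k l
  rw [symbol_multiplierOp (-1) ha heven]
  fin_cases k <;> fin_cases l <;> simp [freq] <;> omega

theorem symbolGrowth_multiplierOp (ha : LinearGrowth a) (heven : ∀ n, a (-n) = a n) {C N : ℝ}
    (hC : 0 < C) (h : ∀ j : ℕ, 1 ≤ j → ‖a j‖ ≤ C * (j : ℝ) ^ N) :
    SymbolGrowth (multiplierOp ε ha) N := by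
  refine ⟨C, hC, 0, fun j hj _ k l => ?_⟩
  rw [symbol_multiplierOp ε ha heven]
  split_ifs
  · exact h j hj
  · rw [norm_zero]
    positivity

end Multiplier

theorem order_le_of_symbolGrowth {A : Op} {N : ℝ} (h : SymbolGrowth A N) : order A ≤ (N : EReal) :=
  sInf_le ⟨N, rfl, h⟩


/-! ### Smooth functions and uniformly convergent series on the two-torus. -/

theorem toDist2_apply (f φ : Smooth lattice2) :
    toDist2 f φ = ∫ z in Set.Ioc 0 (2 * Real.pi) ×ˢ Set.Ioc 0 (2 * Real.pi), f z * φ z := rfl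

theorem toDist2_tensor_tensor (f g φ ψ : Smooth lattice) :
    toDist2 (tensor f g) (tensor φ ψ) = toDist f φ * toDist g ψ := by
  rw [toDist2_apply]
  change ∫ z in Set.Ioc 0 (2 * Real.pi) ×ˢ Set.Ioc 0 (2 * Real.pi),
    (f z.1 * g z.2) * (φ z.1 * ψ z.2) = (∫ x in Set.Ioc 0 (2 * Real.pi), f x * φ x) *
      ∫ x in Set.Ioc 0 (2 * Real.pi), g x * ψ x
  rw [MeasureTheory.Measure.volume_eq_prod, ← MeasureTheory.setIntegral_prod_mul]
  congr 1
  funext z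
  ring

theorem norm_toDist2_apply_le (f φ : Smooth lattice2) :
    ‖toDist2 f φ‖
      ≤ (2 * Real.pi) ^ 2 * (smoothSeminorm lattice2 0 f * smoothSeminorm lattice2 0 φ) := by
  have hvol : MeasureTheory.volume (Set.Ioc 0 (2 * Real.pi) ×ˢ Set.Ioc 0 (2 * Real.pi))
      = ENNReal.ofReal ((2 * Real.pi) ^ 2) := by
    rw [MeasureTheory.Measure.volume_eq_prod, MeasureTheory.Measure.prod_prod, Real.volume_Ioc,
      sub_zero, ← ENNReal.ofReal_mul Real.two_pi_pos.le, sq]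
  rw [toDist2_apply]
  refine (MeasureTheory.norm_setIntegral_le_of_norm_le_const
    (C := smoothSeminorm lattice2 0 f * smoothSeminorm lattice2 0 φ)
    (hvol ▸ ENNReal.ofReal_lt_top) fun z _ => ?_).trans_eq ?_
  · rw [norm_mul]
    exact mul_le_mul (norm_le_smoothSeminorm_zero f z) (norm_le_smoothSeminorm_zero φ z)
      (norm_nonneg _) (apply_nonneg _ _)
  · rw [MeasureTheory.Measure.real, hvol, ENNReal.toReal_ofReal (by positivity), mul_comm]

theorem toDist2_zero : toDist2 0 = 0 := by
  ext φ
  rw [toDist2_apply]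
  refine (MeasureTheory.integral_congr_ae (Filter.Eventually.of_forall fun z => ?_)).trans
    (MeasureTheory.integral_zero _ _)
  exact zero_mul _

/-- The restriction of a smooth function on `𝕋²` to the circle `{t} × 𝕋`. -/
def restrict (g : Smooth lattice2) (t : ℝ) : Smooth lattice :=
  Smooth.mk (fun x => g (t, x)) (g.contDiff.comp (contDiff_const.prodMk contDiff_id))
    (fun γ hγ x => by
      have h := g.periodic (AddSubgroup.mem_prod.mpr ⟨lattice.zero_mem, hγ⟩ : (0, γ) ∈ lattice2)
        (t, x)
      rwa [Prod.mk_add_mk, add_zero] at h)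

theorem smoothSeminorm_restrict_le (g : Smooth lattice2) (t : ℝ) (k : ℕ) :
    smoothSeminorm lattice k (restrict g t) ≤ smoothSeminorm lattice2 k g := by
  refine smoothSeminorm_le k _ fun x => ?_
  have hg : ContDiff ℝ ∞ fun z => g ((t, 0) + z) := g.contDiff.comp (contDiff_const.add contDiff_id)
  have h := (ContinuousLinearMap.inr ℝ ℝ ℝ).iteratedFDeriv_comp_right (i := k) hg x
    (by exact_mod_cast le_top)
  have hc : (⇑(restrict g t) : ℝ → ℂ)
      = (fun z => g ((t, 0) + z)) ∘ ContinuousLinearMap.inr ℝ ℝ ℝ := by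
    funext y
    change g (t, y) = g ((t, 0) + (0, y))
    simp
  rw [hc, h, iteratedFDeriv_comp_add_left]
  refine (ContinuousMultilinearMap.norm_compContinuousLinearMap_le _ _).trans ?_
  refine (mul_le_of_le_one_right (norm_nonneg _) ?_).trans (le_smoothSeminorm k g _)
  exact Finset.prod_le_one (fun _ _ => norm_nonneg _)
    (fun _ _ => ContinuousLinearMap.norm_inr_le_one ℝ ℝ ℝ)

/-- Fourier coefficients of smooth functions on `𝕋²` decay rapidly in the second frequency. -/
theorem norm_toDist2_tensor_expo_mul_pow_le (g : Smooth lattice2) (m n : ℤ) (k : ℕ) :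
    ‖toDist2 g (tensor (expo m) (expo n))‖ * |(n : ℝ)| ^ k
      ≤ (2 * Real.pi) ^ 2 * smoothSeminorm lattice2 k g := by
  have hint : MeasureTheory.IntegrableOn
      (fun z : ℝ × ℝ => g z * tensor (expo m) (expo n) z)
      (Set.Ioc 0 (2 * Real.pi) ×ˢ Set.Ioc 0 (2 * Real.pi))
      ((MeasureTheory.volume : MeasureTheory.Measure ℝ).prod MeasureTheory.volume) := by
    refine MeasureTheory.IntegrableOn.mono_set (t := Set.Icc 0 (2 * Real.pi) ×ˢ
      Set.Icc 0 (2 * Real.pi)) ?_ (Set.prod_mono Set.Ioc_subset_Icc_self Set.Ioc_subset_Icc_self)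
    exact (g.contDiff.continuous.mul (tensor (expo m) (expo n)).contDiff.continuous).continuousOn
      |>.integrableOn_compact (isCompact_Icc.prod isCompact_Icc)
  -- Fubini reduces the estimate to the circle bound on each slice `{t} × 𝕋`, uniformly in `t` and
  -- `m`.
  have h : toDist2 g (tensor (expo m) (expo n))
      = ∫ t in (0 : ℝ)..(2 * Real.pi), expo m t * toDist (restrict g t) (expo n) := by
    rw [toDist2_apply, MeasureTheory.Measure.volume_eq_prod,
      MeasureTheory.setIntegral_prod _ hint, intervalIntegral.integral_of_le Real.two_pi_pos.le]
    congr 1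
    funext t
    rw [toDist_apply, intervalIntegral.integral_of_le Real.two_pi_pos.le,
      ← MeasureTheory.integral_const_mul]
    congr 1
    funext x
    change g (t, x) * (expo m t * expo n x) = expo m t * (g (t, x) * expo n x)
    ring
  rcases eq_or_ne (|(n : ℝ)| ^ k) 0 with h0 | h0
  · rw [h0, mul_zero]
    positivity
  have hpos : 0 < |(n : ℝ)| ^ k := lt_of_le_of_ne (by positivity) h0.symm
  rw [← le_div_iff₀ hpos, h]
  refine (intervalIntegral.norm_integral_le_of_norm_le_const
    (C := 2 * Real.pi * smoothSeminorm lattice2 k g / |(n : ℝ)| ^ k) fun t _ => ?_).trans_eq ?_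
  · rw [norm_mul, norm_expo_apply, one_mul, le_div_iff₀ hpos]
    refine (norm_toDist_expo_mul_pow_le _ n k).trans ?_
    gcongr
    exact smoothSeminorm_restrict_le g t k
  · rw [sub_zero, abs_of_pos Real.two_pi_pos]
    ring

section Series

/-- The sum `∑ G_j` of a series of smooth functions that converges uniformly on `𝕋²`, as a
distribution. -/
def seriesDist (G : ℕ → Smooth lattice2) (hG : Summable fun j => smoothSeminorm lattice2 0 (G j)) :
    Dist lattice2 :=
  have hb : ∀ (φ : Smooth lattice2) (j : ℕ), ‖toDist2 (G j) φ‖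
      ≤ (2 * Real.pi) ^ 2 * smoothSeminorm lattice2 0 φ * smoothSeminorm lattice2 0 (G j) :=
    fun φ j => (norm_toDist2_apply_le (G j) φ).trans_eq (by ring)
  have hs : ∀ φ : Smooth lattice2, Summable fun j => toDist2 (G j) φ := fun φ =>
    Summable.of_norm_bounded (hG.mul_left _) (hb φ)
  let l : Smooth lattice2 →ₗ[ℂ] ℂ :=
    { toFun := fun φ => ∑' j, toDist2 (G j) φ
      map_add' := fun φ ψ => by
        simp only [map_add]
        exact (hs φ).tsum_add (hs ψ)
      map_smul' := fun c φ => by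
        simp only [map_smul, RingHom.id_apply, smul_eq_mul]
        exact tsum_mul_left }
  { toLinearMap := l
    cont := by
      have h0 : 0 ≤ ∑' j, smoothSeminorm lattice2 0 (G j) :=
        tsum_nonneg fun j => apply_nonneg _ _
      refine WithSeminorms.continuous_normedSpace_rng ℂ (withSeminorms (Γ := lattice2)) l
        ⟨{0}, ⟨(2 * Real.pi) ^ 2 * ∑' j, smoothSeminorm lattice2 0 (G j), by positivity⟩, ?_⟩
      intro φ
      rw [Finset.sup_singleton]
      change ‖∑' j, toDist2 (G j) φ‖ ≤ (2 * Real.pi) ^ 2 *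
        (∑' j, smoothSeminorm lattice2 0 (G j)) * smoothSeminorm lattice2 0 φ
      rw [mul_right_comm]
      exact tsum_of_norm_bounded (hG.hasSum.mul_left _) (hb φ) }

variable {G : ℕ → Smooth lattice2} (hG : Summable fun j => smoothSeminorm lattice2 0 (G j))

theorem hasSum_seriesDist (φ : Smooth lattice2) :
    HasSum (fun j => toDist2 (G j) φ) (seriesDist G hG φ) :=
  (Summable.of_norm_bounded (hG.mul_left ((2 * Real.pi) ^ 2 * smoothSeminorm lattice2 0 φ))
    fun j => (norm_toDist2_apply_le (G j) φ).trans_eq (by ring)).hasSum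

end Series

theorem smoothSeminorm_zero_tensor_le (φ ψ : Smooth lattice) :
    smoothSeminorm lattice2 0 (tensor φ ψ)
      ≤ smoothSeminorm lattice 0 φ * smoothSeminorm lattice 0 ψ := by
  refine smoothSeminorm_le 0 _ fun z => ?_
  rw [norm_iteratedFDeriv_zero]
  change ‖φ z.1 * ψ z.2‖ ≤ _
  rw [norm_mul]
  exact mul_le_mul (norm_le_smoothSeminorm_zero φ _) (norm_le_smoothSeminorm_zero ψ _)
    (norm_nonneg _) (apply_nonneg _ _)

/-! ### Integer eigenvalues obstruct global hypoellipticity. -/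

/-- If for each `j` the operator `Q` has an eigenvector in the span of `e^{-ijx}`, `e^{ijx}` with
an integer eigenvalue, then `D_t + Q` has a non-smooth solution of the homogeneous equation. -/
theorem not_globallyHypoelliptic (Q : Op) (T : Smooth lattice →L[ℂ] Smooth lattice)
    (hQ : ∀ u f, Q u f = u (T f)) (m : ℕ → ℤ) (A B : ℕ → ℝ) (hA : ∀ j, 0 ≤ A j)
    (hB : ∀ j, 0 ≤ B j) (hAB : ∀ j, A j + B j = 1 / (j : ℝ) ^ 2)
    (heig : ∀ j : ℕ, Q (toDist ((A j : ℂ) • expo (-j) + (B j : ℂ) • expo j))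
      = -(m j : ℂ) • toDist ((A j : ℂ) • expo (-j) + (B j : ℂ) • expo j)) :
    ¬ GloballyHypoelliptic Q := by
  intro hGH
  set P : ℕ → Smooth lattice := fun j => (A j : ℂ) • expo (-j) + (B j : ℂ) • expo j with hP
  have hPnorm : ∀ j, smoothSeminorm lattice 0 (P j) ≤ 1 / (j : ℝ) ^ 2 := by
    intro j
    rw [← hAB j]
    refine (map_add_le_add _ _ _).trans (add_le_add ?_ ?_)
    · rw [map_smul_eq_mul, Complex.norm_real, Real.norm_of_nonneg (hA j)]
      exact mul_le_of_le_one_right (hA j) (smoothSeminorm_zero_expo_le _)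
    · rw [map_smul_eq_mul, Complex.norm_real, Real.norm_of_nonneg (hB j)]
      exact mul_le_of_le_one_right (hB j) (smoothSeminorm_zero_expo_le _)
  have hG : Summable fun j => smoothSeminorm lattice2 0 (tensor (expo (m j)) (P j)) := by
    refine Summable.of_nonneg_of_le (fun j => apply_nonneg _ _) (fun j => ?_)
      (Real.summable_one_div_nat_pow.mpr one_lt_two)
    refine (smoothSeminorm_zero_tensor_le _ _).trans ?_
    refine (mul_le_of_le_one_left (apply_nonneg _ _) (smoothSeminorm_zero_expo_le _)).trans ?_
    exact hPnorm j
  have hsum := fun φ ψ => hasSum_seriesDist hG (tensor φ ψ)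
  simp only [toDist2_tensor_tensor] at hsum
  -- The solution is `∑ e^{i m_j t} P_j`, with image zero: in each term `D_t` contributes `m_j` and
  -- `Q` contributes `-m_j`.
  obtain ⟨g, hg⟩ := hGH (seriesDist _ hG) 0 (by
    intro φ
    ext ψ
    change 0 = -seriesDist _ hG (tensor (dSmooth φ) ψ)
      + Q (slice (seriesDist _ hG) φ) ψ
    rw [hQ]
    change 0 = -seriesDist _ hG (tensor (dSmooth φ) ψ) + seriesDist _ hG (tensor φ (T ψ))
    refine HasSum.unique ?_ ((hsum (dSmooth φ) ψ).neg.add (hsum φ (T ψ)))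
    convert hasSum_zero using 1
    funext j
    have h1 := congrArg (fun w => w ψ) (heig j)
    simp only [hQ] at h1
    rw [_root_.smul_apply, smul_eq_mul] at h1
    rw [h1, toDist_dSmooth, dSmooth_expo, toDist_smul, _root_.smul_apply, smul_eq_mul]
    ring) ⟨0, toDist2_zero.symm⟩
  -- The integers `m_j` may repeat; the frequencies `±j` in `x` are what separates the terms. The
  -- test frequency `s j` detects the coefficient of `e^{-isjx}`.
  have hcoef : ∀ (j : ℕ) (s : ℤˣ), 1 ≤ j → seriesDist _ hG (tensor (expo (-m j)) (expo (s * j)))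
      = (2 * (Real.pi : ℂ)) ^ 2 * (if s = 1 then A j else B j) := by
    intro j s hj
    refine (hsum _ _).unique ?_
    have hV : ∀ i : ℕ, toDist (P i) (expo (s * j))
        = if i = j then 2 * (Real.pi : ℂ) * (if s = 1 then A j else B j) else 0 := by
      intro i
      rw [hP]
      simp only [toDist_add, toDist_smul, add_apply, _root_.smul_apply, toDist_expo_expo]
      rcases Int.units_eq_one_or s with rfl | rfl
      · have h2 : ¬ ((i : ℤ) + j = 0) := by omega
        by_cases hij : i = j
        · subst hij
          simp [h2]
          ring
        · have h1 : ¬ (-(i : ℤ) + j = 0) := by omega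
          simp [h1, h2, hij]
      · have h2 : ¬ (-(i : ℤ) + -j = 0) := by omega
        by_cases hij : i = j
        · subst hij
          simp [h2]
          ring
        · have h1 : ¬ ((i : ℤ) + -j = 0) := by omega
          simp [h1, h2, hij]
    convert hasSum_single j ?_ using 1
    · rw [toDist_expo_expo, if_pos (add_neg_cancel _), hV, if_pos rfl]
      ring
    · intro i hi
      rw [hV, if_neg hi, mul_zero]
  -- Three derivatives beat the weight `1/j²`: smoothness would give `j = (A j + B j) j³ ≤ 2C` for
  -- all `j ≥ 1`.
  set C := smoothSeminorm lattice2 3 g with hC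
  have hbound : ∀ (j : ℕ) (s : ℤˣ), 1 ≤ j → (if s = 1 then A j else B j) * (j : ℝ) ^ 3 ≤ C := by
    intro j s hj
    have h := norm_toDist2_tensor_expo_mul_pow_le g (-m j) (s * j) 3
    rw [← hg, hcoef j s hj, abs_units_mul, norm_mul, norm_pow, mul_assoc] at h
    have hπ : ‖2 * (Real.pi : ℂ)‖ = 2 * Real.pi := by simp [abs_of_pos Real.pi_pos]
    rw [hπ] at h
    have h := le_of_mul_le_mul_left h (by have := Real.pi_pos; positivity)
    split_ifs at h ⊢
    · simpa [abs_of_nonneg (hA j)] using h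
    · simpa [abs_of_nonneg (hB j)] using h
  obtain ⟨j, hj⟩ := exists_nat_gt (max 1 (2 * C))
  have hj1 : (1 : ℝ) < j := (le_max_left _ _).trans_lt hj
  have hjC : 2 * C < j := (le_max_right _ _).trans_lt hj
  have hjn : 1 ≤ j := by exact_mod_cast hj1.le
  have h1 := hbound j 1 hjn
  have h2 := hbound j (-1) hjn
  rw [if_pos rfl] at h1
  rw [if_neg (by decide)] at h2
  have h3 : (A j + B j) * (j : ℝ) ^ 3 = j := by
    rw [hAB]
    field_simp
  linarith


/-- The hypothesis `heig` is the eigenvector equation for `α D_x` plus the multiplier, expanded into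
exponentials so that it becomes an algebraic identity. -/
theorem not_globallyHypoelliptic_add_multiplierOp (α : ℝ) (ε : ℤˣ) {a : ℤ → ℂ}
    (ha : LinearGrowth a) (heven : ∀ n, a (-n) = a n) (m : ℕ → ℤ) (A B : ℕ → ℝ) (hA : ∀ j, 0 ≤ A j)
    (hB : ∀ j, 0 ≤ B j) (hAB : ∀ j, A j + B j = 1 / (j : ℝ) ^ 2)
    (heig : ∀ j : ℕ,
      ((A j * (-(α * j)) : ℝ) : ℂ) • expo (-j) + ((B j * (α * j) : ℝ) : ℂ) • expo j
        + ((A j : ℂ) * a j) • expo (-(ε * j)) + ((B j : ℂ) * a j) • expo (ε * j)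
      = -(m j : ℂ) • ((A j : ℂ) • expo (-j) + (B j : ℂ) • expo j)) :
    ¬ GloballyHypoelliptic ((α : ℂ) • Dx + multiplierOp ε ha) := by
  -- The transpose of `D_x` is `-D_x`, hence the sign of `α`.
  refine not_globallyHypoelliptic _ (-(α : ℂ) • dSmooth + multiplier ε ha) (fun u f => ?_) m A B
    hA hB hAB fun j => ?_
  · change (α : ℂ) * -(u (dSmooth f)) + u (multiplier ε ha f)
      = u (-(α : ℂ) • dSmooth f + multiplier ε ha f)
    rw [map_add, map_smul, smul_eq_mul]
    ring
  · rw [← toDist_smul, ← heig j]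
    ext f
    simp only [_root_.add_apply, _root_.smul_apply, Dx_toDist, toDist_add, toDist_smul, map_add,
      map_smul, dSmooth_expo, multiplierOp_expo ε ha heven, heven, mul_neg]
    simp only [smul_eq_mul]
    push_cast
    ring

theorem Dx_comp_multiplierOp_one {a : ℤ → ℂ} (ha : LinearGrowth a) :
    Dx.comp (multiplierOp 1 ha) = (multiplierOp 1 ha).comp Dx := by
  ext u : 1
  simpa using Dx_multiplierOp 1 ha u

/-- The two compositions send `e^{ix}` to opposite multiples of `e^{-ix}`, with factors `∓a 1`. -/
theorem Dx_comp_multiplierOp_neg_one_ne {a : ℤ → ℂ} (ha : LinearGrowth a)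
    (heven : ∀ n, a (-n) = a n) (h1 : a 1 ≠ 0) :
    Dx.comp (multiplierOp (-1) ha) ≠ (multiplierOp (-1) ha).comp Dx := by
  intro h
  have h2 := congrArg (fun A : Op => A (toDist (expo 1)) (expo 1)) h
  simp only [ContinuousLinearMap.comp_apply, Dx_toDist, dSmooth_expo, toDist_smul, map_smul,
    multiplierOp_expo (-1) ha heven, _root_.smul_apply, toDist_expo_expo] at h2
  have hπ : (Real.pi : ℂ) ≠ 0 := by exact_mod_cast Real.pi_ne_zero
  simp only [Units.val_neg, Units.val_one, mul_one, Int.cast_neg, Int.cast_one, smul_eq_mul,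
    neg_add_cancel, if_true] at h2
  have h3 : a 1 * Real.pi = 0 := by linear_combination (-1 / 4 : ℂ) * h2
  exact (mul_ne_zero h1 hπ) h3

/-! ### The two symbols and their growth. -/

/-- The distance of `α |n|` to its integer part, with negative sign. -/
def fractSymbol (α : ℝ) (n : ℤ) : ℂ := ((-Int.fract (α * |(n : ℝ)|) : ℝ) : ℂ)

theorem norm_fractSymbol_le (α : ℝ) (n : ℤ) : ‖fractSymbol α n‖ ≤ 1 := by
  rw [fractSymbol, Complex.norm_real, norm_neg, Real.norm_of_nonneg (Int.fract_nonneg _)]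
  exact (Int.fract_lt_one _).le

theorem fractSymbol_neg (α : ℝ) (n : ℤ) : fractSymbol α (-n) = fractSymbol α n := by
  simp [fractSymbol]

theorem linearGrowth_fractSymbol (α : ℝ) : LinearGrowth (fractSymbol α) := by
  refine ⟨1, zero_le_one, fun n => ?_⟩
  rcases eq_or_ne n 0 with rfl | hn
  · simp [fractSymbol]
  · refine (norm_fractSymbol_le α n).trans ?_
    rw [one_mul]
    exact_mod_cast Int.one_le_abs hn

/-- The integer `⌈|α n|⌉`. -/
def ceilAbs (α : ℝ) (n : ℤ) : ℤ := ⌈|α| * |(n : ℝ)|⌉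

/-- The nonnegative `γ` with `α² n² + γ² = ⌈|α n|⌉²`. -/
def sqrtGap (α : ℝ) (n : ℤ) : ℝ := Real.sqrt ((ceilAbs α n : ℝ) ^ 2 - α ^ 2 * (n : ℝ) ^ 2)

theorem sqrtGap_nonneg (α : ℝ) (n : ℤ) : 0 ≤ sqrtGap α n := Real.sqrt_nonneg _

theorem ceilAbs_neg (α : ℝ) (n : ℤ) : ceilAbs α (-n) = ceilAbs α n := by
  simp [ceilAbs]

theorem sqrtGap_neg (α : ℝ) (n : ℤ) : sqrtGap α (-n) = sqrtGap α n := by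
  simp [sqrtGap, ceilAbs_neg]

theorem abs_le_ceilAbs (α : ℝ) (n : ℤ) : |α * n| ≤ ceilAbs α n := by
  rw [abs_mul]
  exact Int.le_ceil _

theorem sq_sqrtGap (α : ℝ) (n : ℤ) :
    sqrtGap α n ^ 2 = (ceilAbs α n : ℝ) ^ 2 - α ^ 2 * (n : ℝ) ^ 2 := by
  refine Real.sq_sqrt ?_
  have h := sq_le_sq' (by linarith [abs_nonneg (α * n), abs_le_ceilAbs α n]) (abs_le_ceilAbs α n)
  rw [sq_abs, mul_pow] at h
  linarith

/-- With `p = ⌈|α n|⌉ < |α n| + 1`, the difference `p² - α² n²` is at most `2|α n| + 1`, linear in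
`|n|`; its root has order `1/2`. -/
theorem sqrtGap_le (α : ℝ) (n : ℤ) :
    sqrtGap α n ≤ (2 * |α| + 1) * Real.sqrt |(n : ℝ)| := by
  rcases eq_or_ne n 0 with rfl | hn
  · simp [sqrtGap, ceilAbs]
  have hn1 : (1 : ℝ) ≤ |(n : ℝ)| := by exact_mod_cast Int.one_le_abs hn
  have h0 := abs_nonneg α
  have h1 : (ceilAbs α n : ℝ) < |α| * |(n : ℝ)| + 1 := Int.ceil_lt_add_one _
  have h2 : |α| * |(n : ℝ)| ≤ ceilAbs α n := Int.le_ceil _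
  have h3 : 0 ≤ |α| * |(n : ℝ)| := by positivity
  refine Real.sqrt_le_iff.mpr ⟨by positivity, ?_⟩
  rw [mul_pow, Real.sq_sqrt (abs_nonneg _), ← sq_abs α, ← sq_abs (n : ℝ), ← mul_pow]
  calc (ceilAbs α n : ℝ) ^ 2 - (|α| * |(n : ℝ)|) ^ 2
      ≤ (|α| * |(n : ℝ)| + 1) ^ 2 - (|α| * |(n : ℝ)|) ^ 2 := by
        gcongr
        linarith
    _ = 2 * |α| * |(n : ℝ)| + 1 := by ring
    _ ≤ (2 * |α| + 1) * |(n : ℝ)| := by linarith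
    _ ≤ (2 * |α| + 1) ^ 2 * |(n : ℝ)| := by
        gcongr
        nlinarith

theorem linearGrowth_sqrtGap (α : ℝ) : LinearGrowth fun n => (sqrtGap α n : ℂ) := by
  refine ⟨2 * |α| + 1, by positivity, fun n => ?_⟩
  rw [Complex.norm_real, Real.norm_of_nonneg (sqrtGap_nonneg α _)]
  refine (sqrtGap_le α n).trans ?_
  rcases eq_or_ne n 0 with rfl | hn
  · simp
  have hn1 : (1 : ℝ) ≤ |(n : ℝ)| := by exact_mod_cast Int.one_le_abs hn
  gcongr
  exact Real.sqrt_le_iff.mpr ⟨abs_nonneg _, by nlinarith⟩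

/-- Vanishing would make `α` equal to plus or minus an integer. This nonzero value is what prevents
commutation with `D_x`. -/
theorem sqrtGap_one_ne_zero {α : ℝ} (hα : Irrational α) : sqrtGap α 1 ≠ 0 := by
  intro h
  have h1 := sq_sqrtGap α 1
  rw [h] at h1
  have h2 : α ^ 2 = (ceilAbs α 1 : ℝ) ^ 2 := by
    push_cast at h1
    linarith
  rcases sq_eq_sq_iff_eq_or_eq_neg.mp h2 with h3 | h3
  · exact hα.ne_int _ h3
  · exact hα.ne_int (-ceilAbs α 1) (by exact_mod_cast h3)

/-- The normalising factor of the eigenvectors for the operator with symbol `sqrtGap`. -/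
def eigWeight (α : ℝ) (j : ℕ) : ℝ :=
  1 / ((j : ℝ) ^ 2 * (2 * (sqrtGap α j + ceilAbs α j)))

/-! ### Construction of the two perturbations. -/

theorem exists_commuting_perturbation (α : ℝ) :
    ∃ S : Op, EInvariant S ∧ SymbolGrowth S (1 / 2) ∧ order S ≤ ((1 / 2 : ℝ) : EReal) ∧
      (∃ r : ℕ → ℝ, symbol S 0 = 0 ∧
        ∀ j : ℕ, 1 ≤ j → symbol S j = !![(r j : ℂ), 0; 0, (r j : ℂ)]) ∧
      Dx.comp S = S.comp Dx ∧ ¬ GloballyHypoelliptic ((α : ℂ) • Dx + S) := by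
  have ha := linearGrowth_fractSymbol α
  have heven := fractSymbol_neg α
  have hgrowth : SymbolGrowth (multiplierOp 1 ha) (1 / 2) := by
    refine symbolGrowth_multiplierOp 1 ha heven one_pos fun j hj => ?_
    refine (norm_fractSymbol_le α j).trans ?_
    rw [one_mul]
    exact Real.one_le_rpow (by exact_mod_cast hj) (by norm_num)
  refine ⟨multiplierOp 1 ha, eInvariant_multiplierOp 1 ha, hgrowth,
    order_le_of_symbolGrowth hgrowth, ⟨fun j => -Int.fract (α * |((j : ℤ) : ℝ)|),
      symbol_multiplierOp_zero 1 ha heven, fun j hj => symbol_multiplierOp_one ha heven hj⟩,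
    Dx_comp_multiplierOp_one ha, ?_⟩
  -- Only `e^{ijx}` is used, with eigenvalue `α j - fract (α j) = ⌊α j⌋`; at `j = 0` the weight
  -- `1/0` is zero.
  refine not_globallyHypoelliptic_add_multiplierOp α 1 ha heven (fun j => -⌊α * j⌋) (fun _ => 0)
    (fun j => 1 / (j : ℝ) ^ 2) (fun _ => le_rfl) (fun j => by positivity) (fun j => zero_add _)
    fun j => ?_
  have hfl : fractSymbol α j = (⌊α * j⌋ : ℂ) - α * j := by
    rw [fractSymbol, Int.cast_natCast, Nat.abs_cast, ← Int.self_sub_floor]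
    push_cast
    ring
  rw [hfl]
  ext x
  simp only [Smooth.add_apply, Smooth.smul_apply, Units.val_one, one_mul]
  push_cast
  ring

theorem exists_noncommuting_perturbation {α : ℝ} (hα : Irrational α) :
    ∃ R : Op, EInvariant R ∧ SymbolGrowth R (1 / 2) ∧ order R ≤ ((1 / 2 : ℝ) : EReal) ∧
      (∃ γ : ℕ → ℝ,
        (symbol R 0 = 0 ∧
          ∀ j : ℕ, 1 ≤ j → symbol R j = !![0, (γ j : ℂ); (γ j : ℂ), 0]) ∧
        ∃ (q : ℕ → ℕ) (p : ℕ → ℤ), StrictMono q ∧ (∀ k, 1 ≤ q k) ∧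
          ∀ k, Real.sqrt (α ^ 2 * (q k : ℝ) ^ 2 + γ (q k) ^ 2) = (p k : ℝ)) ∧
      Dx.comp R ≠ R.comp Dx ∧ ¬ GloballyHypoelliptic ((α : ℂ) • Dx + R) := by
  have ha := linearGrowth_sqrtGap α
  have heven : ∀ n, (sqrtGap α (-n) : ℂ) = sqrtGap α n := fun n => by rw [sqrtGap_neg]
  have hgrowth : SymbolGrowth (multiplierOp (-1) ha) (1 / 2) := by
    refine symbolGrowth_multiplierOp (-1) ha heven (C := 2 * |α| + 1) (by positivity)
      fun j hj => ?_
    rw [Complex.norm_real, Real.norm_of_nonneg (sqrtGap_nonneg α _)]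
    refine (sqrtGap_le α j).trans_eq ?_
    rw [Real.sqrt_eq_rpow]
    simp
  have hγ0 : ∀ j : ℕ, 0 ≤ sqrtGap α j := fun j => sqrtGap_nonneg α j
  have hp := fun j : ℕ => abs_le.mp (abs_le_ceilAbs α j)
  have hp0 : ∀ j : ℕ, (0 : ℝ) ≤ ceilAbs α j := fun j => (abs_nonneg _).trans (abs_le_ceilAbs α j)
  have hsq := fun j : ℕ => sq_sqrtGap α j
  simp only [Int.cast_natCast] at hp hsq
  have hw : ∀ j, 0 ≤ eigWeight α j := fun j => by
    have := hγ0 j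
    have := hp0 j
    unfold eigWeight
    positivity
  refine ⟨multiplierOp (-1) ha, eInvariant_multiplierOp (-1) ha, hgrowth,
    order_le_of_symbolGrowth hgrowth, ⟨fun j => sqrtGap α j,
      ⟨symbol_multiplierOp_zero (-1) ha heven,
        fun j hj => symbol_multiplierOp_neg_one ha heven hj⟩,
      -- The root is an integer at every frequency, so `q` can run through all positive integers.
      fun k => k + 1, fun k => ceilAbs α (k + 1 : ℕ), fun _ _ h => Nat.succ_lt_succ h,
      fun k => Nat.le_add_left 1 k, fun k => ?_⟩,
    Dx_comp_multiplierOp_neg_one_ne ha heven ?_, ?_⟩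
  · rw [hsq, add_sub_cancel, Real.sqrt_sq (hp0 _)]
  · exact_mod_cast sqrtGap_one_ne_zero hα
  -- For the eigenvalue `p = ⌈|α j|⌉`, both `(γ, p + α j)` and `(p - α j, γ)` solve the eigenvector
  -- equation. Their sum has nonnegative entries of total `2(γ + p)`, which `eigWeight` normalises
  -- to `1/j²`.
  refine not_globallyHypoelliptic_add_multiplierOp α (-1) ha heven (fun j => -ceilAbs α j)
    (fun j => eigWeight α j * (sqrtGap α j + (ceilAbs α j - α * j)))
    (fun j => eigWeight α j * (sqrtGap α j + (ceilAbs α j + α * j)))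
    (fun j => mul_nonneg (hw j) (add_nonneg (hγ0 j) (by linarith [hp j])))
    (fun j => mul_nonneg (hw j) (add_nonneg (hγ0 j) (by linarith [hp j]))) (fun j => ?_)
    fun j => ?_
  · rcases Nat.eq_zero_or_pos j with rfl | hj
    · simp [eigWeight]
    have hj' : (0 : ℝ) < j := by exact_mod_cast hj
    have hpos : 0 < sqrtGap α j + ceilAbs α j := by
      have h1 : (0 : ℝ) < |α * j| := abs_pos.mpr (mul_ne_zero hα.ne_zero hj'.ne')
      have h2 := abs_le_ceilAbs α j
      rw [Int.cast_natCast] at h2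
      linarith [hγ0 j]
    unfold eigWeight
    field_simp
    ring
  · have hsqC : (sqrtGap α j : ℂ) ^ 2 = (ceilAbs α j : ℂ) ^ 2 - (α : ℂ) ^ 2 * (j : ℂ) ^ 2 := by
      exact_mod_cast hsq j
    ext x
    simp only [Smooth.add_apply, Smooth.smul_apply, Units.val_one, Units.val_neg, one_mul,
      neg_mul, neg_neg]
    push_cast
    -- Both components of the eigenvector equation reduce to `γ² + α² j² = p²`.
    linear_combination (eigWeight α j : ℂ) * (expo j x + expo (-j) x) * hsqC

end

end TorusGH

theorem theorem4p4 (α : ℝ) (hα : Irrational α) :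
    (∃ S : TorusGH.Op,
      TorusGH.EInvariant S ∧
      TorusGH.SymbolGrowth S (1 / 2) ∧ TorusGH.order S ≤ ((1 / 2 : ℝ) : EReal) ∧
      (∃ r : ℕ → ℝ, TorusGH.symbol S 0 = 0 ∧
        ∀ j : ℕ, 1 ≤ j → TorusGH.symbol S j = !![(r j : ℂ), 0; 0, (r j : ℂ)]) ∧
      TorusGH.Dx.comp S = S.comp TorusGH.Dx ∧
      ¬ TorusGH.GloballyHypoelliptic ((α : ℂ) • TorusGH.Dx + S)) ∧
    (∃ R : TorusGH.Op,
      TorusGH.EInvariant R ∧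
      TorusGH.SymbolGrowth R (1 / 2) ∧ TorusGH.order R ≤ ((1 / 2 : ℝ) : EReal) ∧
      (∃ γ : ℕ → ℝ,
        (TorusGH.symbol R 0 = 0 ∧
          ∀ j : ℕ, 1 ≤ j → TorusGH.symbol R j = !![0, (γ j : ℂ); (γ j : ℂ), 0]) ∧
        ∃ (q : ℕ → ℕ) (p : ℕ → ℤ), StrictMono q ∧ (∀ k, 1 ≤ q k) ∧
          ∀ k, Real.sqrt (α ^ 2 * (q k : ℝ) ^ 2 + γ (q k) ^ 2) = (p k : ℝ)) ∧
      TorusGH.Dx.comp R ≠ R.comp TorusGH.Dx ∧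
      ¬ TorusGH.GloballyHypoelliptic ((α : ℂ) • TorusGH.Dx + R)) :=
  ⟨TorusGH.exists_commuting_perturbation α, TorusGH.exists_noncommuting_perturbation hα⟩
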